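/- Let $k\ge 2$ and $m=n-k\ge 1$ be integers. For $\Omega\subset\mathbb R^{m}$ and $f:\Omega\to[0,\infty)$, the spherical array $\Omega\times_f S^{k-1}$ with base $\Omega$ and warping function $f$ is the set $$H=\{(x'',x')\in\Omega\times\mathbb R^k:\ \|x'\|^2=f(x'')^2\}\subset\mathbb R^{n-k}\times\mathbb R^k=\mathbb R^n .$$ Let $\pi:\mathbb R^{n-k}\times\mathbb R^k\to\mathbb R^{n-k}$ be the orthogonal projection. A set $H\subset\mathbb R^n$ satisfies the Archimedean projection property (APP) corresponding to $\pi$ with constant of proportionality $C\in(0,\infty)$ if, for every Lebesgue measurable $U\subset\pi(H)$, $$\mathrm{Vol}_{n-1}\bigl(H\cap\pi^{-1}(U)\bigr)=C\cdot\mathrm{Vol}_{n-k}(U),$$ where $\mathrm{Vol}_{n-1}$ is the $(n-1)$-dimensional Hausdorff measure (normalized to agree with Lebesgue measure on $\mathbb R^{n-1}$) and $\mathrm{Vol}_{n-k}$ is Lebesgue measure. Let $\mathrm{Vol}(S^{k-1}(1))$ be the $(k-1)$-dimensional volume of the unit sphere of $\mathbb R^k$, put $$M_k=\int_0^1\frac{t^{k-1}}{\sqrt{1-t^{2k-2}}}\,dt,$$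 and let the codimension $k$ Archimedean scaling function $f_k:[0,M_k]\to[0,1]$ be the inverse of the function $$[0,1]\to[0,M_k],\qquad y\mapsto\int_0^y \frac{t^{k-1}}{\sqrt{1-t^{2k-2}}}\,dt .$$ **Theorem 1.** Let $\Omega\subset\mathbb R^{n-k}$ be a domain (a non-empty connected open set). (a) Suppose that $f$ is a nonnegative, continuously differentiable function on $\Omega$ such that $H=\Omega\times_f S^{k-1}$ satisfies the APP corresponding to orthogonal projection onto its base with constant $C=\mathrm{Vol}(S^{k-1}(1))$. Then $f(x'')\le 1$ for all $x''\in\Omega$, and there is a positive, continuously differentiable solution $\omega\le M_k$ of the eikonal equation $\|\nabla\omega\|=1$ on $A=\{x''\in\Omega:0<f(x'')<1\}$ such that $f=f_k\circ\omega$ on $A$. (b) Conversely, suppose that $\omega$ is a positive, continuously differentiable solution of $\|\nabla\omega\|=1$ on $\Omega$ with $\omega(x'')\le M_k$ for all $x''\in\Omega$. Let $B=\{x''\in\Omega:0<\omega(x'')\le M_k\}$. Then $f=f_k\circ\omega$ is a nonnegative, continuously differentiable function on $B$, and the spherical array $B\times_f S^{k-1}\subset\mathbb R^{n-k}\times\mathbb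 R^k$ satisfies the APP corresponding to orthogonal projection onto its base with constant $C=\mathrm{Vol}(S^{k-1}(1))$. -/

import Mathlib

open MeasureTheory Set
open scoped ENNReal

/-- Euclidean space `ℝ^d` with its Euclidean norm. -/
abbrev Euc (d : ℕ) : Type := EuclideanSpace ℝ (Fin d)

/-- The ambient space `ℝ^m × ℝ^k = ℝ^(m+k)` with its Euclidean norm; the first factor carries the
base, the second one the spherical fibers. -/
abbrev Ambient (m k : ℕ) : Type := WithLp 2 (Euc m × Euc k)

/-- The orthogonal projection (of codimension `k`) of `ℝ^m × ℝ^k` onto `ℝ^m`. -/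
def baseProj {m k : ℕ} (p : Ambient m k) : Euc m := p.fst

/-- The spherical array `Ω ×_f S^(k-1)`, embedded in `ℝ^m × ℝ^k`: over each `x` in the base `Ω`
lies the sphere of radius `f x` centered at `x`. -/
def sphericalArray {m : ℕ} (k : ℕ) (Ω : Set (Euc m)) (f : Euc m → ℝ) : Set (Ambient m k) :=
  {p | p.fst ∈ Ω ∧ ‖p.snd‖ ^ 2 = f p.fst ^ 2}

/-- The Archimedean projection property of a hypersurface `H` of `ℝ^m × ℝ^k` for the projection
onto `ℝ^m`, with constant of proportionality `C`. Volumes of parts of `H` are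
`(m+k-1)`-dimensional Hausdorff measures in the Euclidean normalization, and the sets `U` are the
Lebesgue measurable subsets of the projection of `H`. -/
def SatisfiesAPP {m k : ℕ} (H : Set (Ambient m k)) (C : ℝ≥0∞) : Prop :=
  C ≠ 0 ∧ C ≠ ∞ ∧
    ∀ U : Set (Euc m), U ⊆ baseProj '' H → NullMeasurableSet U volume →
      μHE[m + k - 1] (H ∩ baseProj ⁻¹' U) = C * volume U

/-- The `(k-1)`-dimensional volume of the unit sphere `S^(k-1)(1)` of `ℝ^k`. -/
noncomputable def unitSphereVol (k : ℕ) : ℝ≥0∞ :=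
  μHE[k - 1] (Metric.sphere (0 : Euc k) 1)

/-- The function `y ↦ ∫_0^y t^(k-1) / √(1 - t^(2k-2)) dt`, used for `0 ≤ y ≤ 1`. -/
noncomputable def archimedeanIntegral (k : ℕ) (y : ℝ) : ℝ :=
  ∫ t in (0 : ℝ)..y, t ^ (k - 1) / √(1 - t ^ (2 * k - 2))

/-- The number `M_k = ∫_0^1 t^(k-1) / √(1 - t^(2k-2)) dt`. -/
noncomputable def archimedeanBound (k : ℕ) : ℝ := archimedeanIntegral k 1

/-- The codimension `k` Archimedean scaling function `f_k : [0, M_k] → [0, 1]`, the inverse of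
`archimedeanIntegral k : [0, 1] → [0, M_k]`; its values outside `[0, M_k]` are arbitrary. -/
noncomputable def archimedeanScaling (k : ℕ) : ℝ → ℝ :=
  Function.invFunOn (archimedeanIntegral k) (Icc 0 1)

/-- `ω` is a positive, continuously differentiable solution of `‖∇ω‖ = 1` on the (open) set `S`. -/
def IsPositiveEikonalSolution {m : ℕ} (ω : Euc m → ℝ) (S : Set (Euc m)) : Prop :=
  (∀ x ∈ S, 0 < ω x) ∧ ContDiffOn ℝ 1 ω S ∧ ∀ x ∈ S, ‖gradient ω x‖ = 1

/-! Over the part of the base where `f > 0`, the array is parametrized, up to a null set, by `(x, w)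
↦ (x, f x • σ w)` with `σ` the inverse stereographic projection. Squared distances split into `‖x -
y‖² + (f x - f y)²`, the metric of the graph of `f`, and a spherical part that is conformal in `w`
with factor `f x * stereoFactor w`. The Jacobian is therefore `√(1 + ‖∇f‖²) * (f x * stereoFactor w)
^ (k - 1)`, and Tonelli turns the volume over `U` into `Vol(S^(k-1)) * ∫_U √(1 + ‖∇f‖²) * f ^ (k -
1)`. Since the volume of the sphere is neither `0` nor `∞` and the density is continuous, the APP
says exactly that `√(1 + ‖∇f‖²) * f ^ (k - 1) = 1` on `Ω` (`satisfiesAPP_sphericalArray_iff`).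

This equation forces `f ≤ 1`. Where `0 < f < 1` it reads `F'(f) * ‖∇f‖ = 1` with `F =
archimedeanIntegral k`, so it is the eikonal equation for `ω = F ∘ f`; this gives (a), and (b) is
the same computation for `f = F⁻¹ ∘ ω`. In (b) the value `M_k` is never attained, because `∇ω` would
vanish at such a maximum, so only the open interval on which `F⁻¹` is shown to be `C¹` matters. -/

open Filter Topology NNReal Module

/-! ### Area formula for Hausdorff measure by local comparison with model maps. -/

section AreaFormula

variable {X Y V : Type*}
  [MetricSpace Y] [MeasurableSpace Y] [BorelSpace Y]
  [MetricSpace V] [MeasurableSpace V] [BorelSpace V]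

/-- Hausdorff measures of images under two maps compare if the first map does not separate points
more than `K` times as much as the second one. -/
theorem euclideanHausdorffMeasure_image_le_of_dist_le (d : ℕ) {f : X → Y} {g : X → V} {T : Set X}
    {K : ℝ≥0} (h : ∀ a ∈ T, ∀ b ∈ T, dist (f a) (f b) ≤ K * dist (g a) (g b)) :
    μHE[d] (f '' T) ≤ (K : ℝ≥0∞) ^ d * μHE[d] (g '' T) := by
  rcases T.eq_empty_or_nonempty with rfl | ⟨x₀, -⟩
  · simp
  have : Nonempty X := ⟨x₀⟩
  -- `ψ = f ∘ g⁻¹` does not depend on the chosen preimage: `g a = g b` forces `f a = f b`.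
  set ψ : V → Y := fun v => f (Function.invFunOn g T v) with hψ
  have hmem : ∀ a ∈ T, Function.invFunOn g T (g a) ∈ T ∧ g (Function.invFunOn g T (g a)) = g a :=
    fun a ha => Function.invFunOn_pos ⟨a, ha, rfl⟩
  have hval : ∀ a ∈ T, ψ (g a) = f a := by
    intro a ha
    have := h _ (hmem a ha).1 a ha
    rw [(hmem a ha).2, dist_self, mul_zero] at this
    exact dist_le_zero.1 this
  have himg : ψ '' (g '' T) = f '' T := by
    rw [image_image]
    exact image_congr hval
  have hlip : LipschitzOnWith K ψ (g '' T) := by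
    apply LipschitzOnWith.of_dist_le_mul
    rintro _ ⟨a, ha, rfl⟩ _ ⟨b, hb, rfl⟩
    rw [hval a ha, hval b hb]
    exact h a ha b hb
  have := hlip.hausdorffMeasure_image_le (d := (d : ℝ)) (by positivity)
  rw [himg, ENNReal.rpow_natCast] at this
  simp_rw [Measure.euclideanHausdorffMeasure_def, Measure.smul_apply, ENNReal.smul_def, smul_eq_mul]
  rw [mul_left_comm]
  gcongr

theorem ENNReal.le_of_forall_one_lt_le_pow_mul {a b : ℝ≥0∞} (n : ℕ)
    (h : ∀ r : ℝ≥0, 1 < r → a ≤ (r : ℝ≥0∞) ^ n * b) : a ≤ b := by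
  have h1 : Tendsto (fun r : ℝ≥0 => (r : ℝ≥0∞) ^ n * b) (𝓝[>] 1) (𝓝 (((1 : ℝ≥0) : ℝ≥0∞) ^ n * b)) :=
    by
    refine ENNReal.Tendsto.mul_const ?_ (Or.inl (by simp))
    exact (((ENNReal.continuous_pow n).comp ENNReal.continuous_coe).tendsto 1).mono_left
      nhdsWithin_le_nhds
  have := ge_of_tendsto h1 (eventually_nhdsWithin_of_forall h)
  simpa using this

variable [TopologicalSpace X] [PolishSpace X] [MeasurableSpace X] [BorelSpace X]

/-- Area formula: if near each point of `s` the injective map `φ` is bi-Lipschitz comparable, with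
constant arbitrarily close to `1`, to a map that scales the measure `μ` by a constant `c` close to
`g`, then `g` is the Jacobian of `φ`. -/
theorem euclideanHausdorffMeasure_image_eq_lintegral (d : ℕ) {μ : Measure X} {s : Set X}
    (hs : MeasurableSet s) {φ : X → Y} (hφ : InjOn φ s) (hφc : ContinuousOn φ s) {g : X → ℝ≥0∞}
    (h : ∀ x ∈ s, ∀ r : ℝ≥0, 1 < r → ∃ (L : X → V) (c : ℝ≥0∞),
      (∀ t, MeasurableSet t → μHE[d] (L '' t) = c * μ t) ∧
      (∀ᶠ p in 𝓝 x ×ˢ 𝓝 x, dist (φ p.1) (φ p.2) ≤ r * dist (L p.1) (L p.2) ∧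
        dist (L p.1) (L p.2) ≤ r * dist (φ p.1) (φ p.2)) ∧
      ∀ᶠ y in 𝓝 x, c ≤ r * g y ∧ g y ≤ r * c) :
    μHE[d] (φ '' s) = ∫⁻ x in s, g x ∂μ := by
  rcases s.eq_empty_or_nonempty with rfl | hne
  · simp
  -- Of the `d + 1` factors `r`, `d` come from the Lipschitz comparison of `φ` with `L` and one from
  -- that of `g` with `c`.
  suffices H : ∀ r : ℝ≥0, 1 < r →
      μHE[d] (φ '' s) ≤ (r : ℝ≥0∞) ^ (d + 1) * ∫⁻ x in s, g x ∂μ ∧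
      ∫⁻ x in s, g x ∂μ ≤ (r : ℝ≥0∞) ^ (d + 1) * μHE[d] (φ '' s) from
    le_antisymm (ENNReal.le_of_forall_one_lt_le_pow_mul _ fun r hr => (H r hr).1)
      (ENNReal.le_of_forall_one_lt_le_pow_mul _ fun r hr => (H r hr).2)
  intro r hr
  have h' : ∀ x : X, ∃ u : Set X, IsOpen u ∧ (x ∈ s → x ∈ u) ∧ ∀ T ⊆ u ∩ s, MeasurableSet T →
      μHE[d] (φ '' T) ≤ (r : ℝ≥0∞) ^ (d + 1) * ∫⁻ x in T, g x ∂μ ∧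
      ∫⁻ x in T, g x ∂μ ≤ (r : ℝ≥0∞) ^ (d + 1) * μHE[d] (φ '' T) := by
    intro x
    by_cases hx : x ∈ s
    swap
    · refine ⟨∅, isOpen_empty, fun h => (hx h).elim, fun T hT _ => ?_⟩
      obtain rfl : T = ∅ := by simpa using hT
      simp
    obtain ⟨L, c, hL, hd, hg⟩ := h x hx r hr
    obtain ⟨N, hN, hNd'⟩ := mem_prod_same_iff.1 hd
    have hNd : ∀ a ∈ N, ∀ b ∈ N, dist (φ a) (φ b) ≤ r * dist (L a) (L b) ∧
        dist (L a) (L b) ≤ r * dist (φ a) (φ b) := fun a ha b hb => hNd' (mk_mem_prod ha hb)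
    obtain ⟨u, hu, huo, hxu⟩ := _root_.mem_nhds_iff.1 (inter_mem hN hg)
    refine ⟨u, huo, fun _ => hxu, fun T hT hTm => ?_⟩
    have hTN : ∀ a ∈ T, a ∈ N := fun a ha => (hu (hT ha).1).1
    have hTg : ∀ a ∈ T, c ≤ r * g a ∧ g a ≤ r * c := fun a ha => (hu (hT ha).1).2
    have e1 := euclideanHausdorffMeasure_image_le_of_dist_le d (f := φ) (g := L) (T := T) (K := r)
      fun a ha b hb => (hNd a (hTN a ha) b (hTN b hb)).1
    have e2 := euclideanHausdorffMeasure_image_le_of_dist_le d (f := L) (g := φ) (T := T) (K := r)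
      fun a ha b hb => (hNd a (hTN a ha) b (hTN b hb)).2
    rw [hL T hTm] at e1 e2
    have i1 : c * μ T ≤ r * ∫⁻ x in T, g x ∂μ := by
      rw [← setLIntegral_const, ← lintegral_const_mul' _ _ ENNReal.coe_ne_top]
      exact setLIntegral_mono' hTm fun a ha => (hTg a ha).1
    have i2 : ∫⁻ x in T, g x ∂μ ≤ r * (c * μ T) := by
      rw [← mul_assoc, ← setLIntegral_const]
      exact setLIntegral_mono' hTm fun a ha => (hTg a ha).2
    constructor
    · calc _ ≤ _ := e1
        _ ≤ (r : ℝ≥0∞) ^ d * (r * ∫⁻ x in T, g x ∂μ) := by gcongr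
        _ = _ := by ring
    · calc _ ≤ _ := i2
        _ ≤ r * ((r : ℝ≥0∞) ^ d * μHE[d] (φ '' T)) := by gcongr
        _ = _ := by ring
  choose u huo hxu hu using h'
  obtain ⟨t, hts, htc, hcov⟩ := TopologicalSpace.countable_cover_nhdsWithin (f := u) (s := s)
    fun x hx => mem_nhdsWithin_of_mem_nhds ((huo x).mem_nhds (hxu x hx))
  have htne : t.Nonempty := by
    obtain ⟨x, hx⟩ := hne
    obtain ⟨y, hy, -⟩ := mem_iUnion₂.1 (hcov hx)
    exact ⟨y, hy⟩
  obtain ⟨e, rfl⟩ := htc.exists_eq_range htne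
  -- Disjoint pieces make both sides countably additive; injectivity of `φ` keeps their images
  -- disjoint.
  set T : ℕ → Set X := fun n => s ∩ disjointed (fun n => u (e n)) n with hT
  have hTm : ∀ n, MeasurableSet (T n) := fun n =>
    hs.inter (MeasurableSet.disjointed (fun n => (huo (e n)).measurableSet) n)
  have hTd : Pairwise (Function.onFun Disjoint T) := fun i j hij =>
    ((disjoint_disjointed fun n => u (e n)) hij).mono inter_subset_right inter_subset_right
  have hTU : ⋃ n, T n = s := by
    rw [← inter_iUnion, iUnion_disjointed, inter_eq_left]
    intro x hx
    simpa using hcov hx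
  have hTs : ∀ n, T n ⊆ s := fun n => inter_subset_left
  have hTu : ∀ n, T n ⊆ u (e n) ∩ s := fun n =>
    fun x hx => ⟨disjointed_subset (fun n => u (e n)) n hx.2, hx.1⟩
  have E1 : μHE[d] (φ '' s) = ∑' n, μHE[d] (φ '' T n) := by
    conv_lhs => rw [← hTU, image_iUnion]
    refine measure_iUnion (fun i j hij => ?_) fun n =>
      (hTm n).image_of_continuousOn_injOn (hφc.mono (hTs n)) (hφ.mono (hTs n))
    rw [Function.onFun, disjoint_left]
    rintro _ ⟨a, ha, rfl⟩ ⟨b, hb, hab⟩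
    rw [hφ (hTs j hb) (hTs i ha) hab] at hb
    exact disjoint_left.1 (hTd hij) ha hb
  have E2 : ∫⁻ x in s, g x ∂μ = ∑' n, ∫⁻ x in T n, g x ∂μ := by
    conv_lhs => rw [← hTU]
    exact lintegral_iUnion hTm hTd g
  rw [E1, E2, ← ENNReal.tsum_mul_left, ← ENNReal.tsum_mul_left]
  exact ⟨ENNReal.tsum_le_tsum fun n => (hu _ _ (hTu n) (hTm n)).1,
    ENNReal.tsum_le_tsum fun n => (hu _ _ (hTu n) (hTm n)).2⟩

end AreaFormula

/-! ### Chordal distance and conformal factor of stereographic projection. -/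

section Stereographic

/-- The conformal factor of the inverse stereographic projection. -/
noncomputable def stereoFactor {E : Type*} [NormedAddCommGroup E] (w : E) : ℝ := 4 / (‖w‖ ^ 2 + 4)

theorem stereoFactor_pos {E : Type*} [NormedAddCommGroup E] (w : E) : 0 < stereoFactor w := by unfold stereoFactor; positivity

theorem continuous_stereoFactor {E : Type*} [NormedAddCommGroup E] :
    Continuous (stereoFactor : E → ℝ) := by
  unfold stereoFactor
  exact continuous_const.div (by fun_prop) fun w => by positivity

variable {E : Type*} [NormedAddCommGroup E] [InnerProductSpace ℝ E]

/-- Conformality as an exact identity between two points at any distance, so that the area formula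
needs no derivative of the chart. -/
theorem norm_stereoInvFun_sub_sq {v : E} (hv : ‖v‖ = 1) (u w : (ℝ ∙ v)ᗮ) :
    ‖(stereoInvFun hv u : E) - stereoInvFun hv w‖ ^ 2 =
      stereoFactor u * stereoFactor w * ‖u - w‖ ^ 2 := by
  have n1 : ‖(stereoInvFun hv u : E)‖ = 1 := norm_eq_of_mem_sphere _
  have n2 : ‖(stereoInvFun hv w : E)‖ = 1 := norm_eq_of_mem_sphere _
  have hu : inner ℝ (u : E) v = 0 := Submodule.mem_orthogonal_singleton_iff_inner_left.1 u.2
  have hw : inner ℝ v (w : E) = 0 := Submodule.mem_orthogonal_singleton_iff_inner_right.1 w.2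
  have hvv : inner ℝ v v = 1 := by rw [real_inner_self_eq_norm_sq, hv, one_pow]
  rw [norm_sub_sq_real, n1, n2, norm_sub_sq_real, stereoInvFun_apply, stereoInvFun_apply]
  simp only [inner_smul_left, inner_smul_right, inner_add_left, inner_add_right, hu, hw, hvv,
    stereoFactor, Submodule.coe_inner, map_inv₀, conj_trivial, Submodule.coe_norm]
  have h1 : ‖(u : E)‖ ^ 2 + 4 ≠ 0 := by positivity
  have h2 : ‖(w : E)‖ ^ 2 + 4 ≠ 0 := by positivity
  field_simp
  ring

theorem stereoInvFun_injective {v : E} (hv : ‖v‖ = 1) : Function.Injective (stereoInvFun hv) :=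
  fun u w h => by rw [← stereo_right_inv hv u, h, stereo_right_inv]

theorem exists_stereoInvFun_eq {v : E} (hv : ‖v‖ = 1) {e : E} (he : ‖e‖ = 1) (hne : e ≠ v) :
    ∃ w, (stereoInvFun hv w : E) = e :=
  ⟨_, congrArg Subtype.val (stereo_left_inv hv (x := ⟨e, by simpa using he⟩) hne)⟩

theorem norm_smul_sub_smul_sq {e₁ e₂ : E} (h₁ : ‖e₁‖ = 1) (h₂ : ‖e₂‖ = 1) (a b : ℝ) :
    ‖a • e₁ - b • e₂‖ ^ 2 = (a - b) ^ 2 + a * b * ‖e₁ - e₂‖ ^ 2 := by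
  simp only [norm_sub_sq_real, norm_smul, inner_smul_left, inner_smul_right, h₁, h₂,
    Real.norm_eq_abs, mul_one, sq_abs, conj_trivial]
  ring

theorem lintegral_stereoFactor_ne_zero [FiniteDimensional ℝ E] [MeasurableSpace E] [BorelSpace E]
    (n : ℕ) : ∫⁻ w : E, ENNReal.ofReal (stereoFactor w ^ n) ≠ 0 := by
  rw [Ne, lintegral_eq_zero_iff]
  · intro h
    obtain ⟨w, hw⟩ := h.exists
    have := pow_pos (stereoFactor_pos w) n
    simp only [Pi.zero_apply, ENNReal.ofReal_eq_zero] at hw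
    linarith
  · exact (continuous_stereoFactor.pow n).measurable.ennreal_ofReal

/-- The integrand is at most `4 ^ n * (1 + ‖w‖²) ^ (-n)`, which is integrable in dimension `n`
because `2 * n > n`. -/
theorem lintegral_stereoFactor_ne_top [FiniteDimensional ℝ E] [MeasurableSpace E] [BorelSpace E]
    {n : ℕ} (hn : n = finrank ℝ E) (hpos : 0 < n) :
    ∫⁻ w : E, ENNReal.ofReal (stereoFactor w ^ n) ≠ ∞ := by
  have h := (integrable_rpow_neg_one_add_norm_sq (E := E) (μ := volume) (r := 2 * n) (by
    rw [← hn]; have : (0 : ℝ) < n := by exact_mod_cast hpos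
    linarith)).const_mul ((4 : ℝ) ^ n)
  refine ne_top_of_le_ne_top h.lintegral_lt_top.ne (lintegral_mono fun w => ?_)
  apply ENNReal.ofReal_le_ofReal
  have : (-(2 * (n : ℝ)) / 2) = -(n : ℝ) := by ring
  rw [this, Real.rpow_neg (by positivity), Real.rpow_natCast, stereoFactor, div_pow, div_eq_mul_inv]
  exact mul_le_mul_of_nonneg_left (inv_anti₀ (by positivity)
    (pow_le_pow_left₀ (by positivity) (by linarith) n)) (by positivity)

end Stereographic

/-! ### Linear model for the metric of a graph. -/

section Model

variable {E : Type*} [NormedAddCommGroup E] [InnerProductSpace ℝ E]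

/-- The rank one perturbation of the identity that pulls back the metric of the graph of the
linear functional `⟪g, ·⟫`. -/
theorem exists_linearMap_norm_sq_eq_add_inner_sq [FiniteDimensional ℝ E] (g : E) :
    ∃ P : E →ₗ[ℝ] E, LinearMap.det P = √(1 + ‖g‖ ^ 2) ∧
      ∀ a, ‖P a‖ ^ 2 = ‖a‖ ^ 2 + inner ℝ g a ^ 2 := by
  rcases eq_or_ne g 0 with rfl | hg
  · exact ⟨LinearMap.id, by simp, by simp⟩
  have hg' : ‖g‖ ^ 2 ≠ 0 := by positivity
  set s := √(1 + ‖g‖ ^ 2)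
  have hs : s ^ 2 = 1 + ‖g‖ ^ 2 := Real.sq_sqrt (by positivity)
  -- This map fixes the orthogonal complement of `g` and stretches `g` by `s = √(1 + ‖g‖²)`.
  refine ⟨LinearMap.transvection (innerₗ E g) (((s - 1) / ‖g‖ ^ 2) • g), ?_, fun a => ?_⟩
  · rw [LinearMap.transvection.det, innerₗ_apply_apply, inner_smul_right,
      real_inner_self_eq_norm_sq]
    field_simp
    ring
  · rw [LinearMap.transvection.apply, innerₗ_apply_apply, norm_add_sq_real, norm_smul, norm_smul,
      inner_smul_right, inner_smul_right, real_inner_comm g a, mul_pow, mul_pow, Real.norm_eq_abs,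
      Real.norm_eq_abs, sq_abs, sq_abs]
    field_simp
    linear_combination (inner ℝ g a) ^ 2 * hs

end Model

/-! ### Estimates with ratio close to one. -/

section LocalComparison

theorem eventually_le_mul_and_le_mul {X : Type*} [TopologicalSpace X] {q : X → ℝ} {x : X}
    (hq : ContinuousAt q x) (hx : 0 < q x) {r : ℝ} (hr : 1 < r) :
    ∀ᶠ y in 𝓝 x, q x ≤ r * q y ∧ q y ≤ r * q x := by
  have h1 : ∀ᶠ y in 𝓝 x, q x < r * q y :=
    (hq.const_mul r).eventually (lt_mem_nhds (by nlinarith))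
  have h2 : ∀ᶠ y in 𝓝 x, q y < r * q x := hq.eventually (gt_mem_nhds (by nlinarith))
  filter_upwards [h1, h2] with y a b using ⟨a.le, b.le⟩

theorem eventually_ofReal_le_mul_and_le_mul {X : Type*} [TopologicalSpace X] {q : X → ℝ} {x : X}
    (hq : ContinuousAt q x) (hx : 0 < q x) {r : ℝ≥0} (hr : 1 < r) :
    ∀ᶠ y in 𝓝 x, ENNReal.ofReal (q x) ≤ r * ENNReal.ofReal (q y) ∧
      ENNReal.ofReal (q y) ≤ r * ENNReal.ofReal (q x) := by
  filter_upwards [eventually_le_mul_and_le_mul hq hx (r := r) (by exact_mod_cast hr)] with y hy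
  rw [← ENNReal.ofReal_coe_nnreal, ← ENNReal.ofReal_mul r.coe_nonneg,
    ← ENNReal.ofReal_mul r.coe_nonneg]
  exact ⟨ENNReal.ofReal_le_ofReal hy.1, ENNReal.ofReal_le_ofReal hy.2⟩

/-- For a graph, `q` is the horizontal displacement, `p` the vertical one and `e` the linearization
error; the cross term is absorbed by `2 * |p| * q ≤ p² + q²`. -/
theorem sq_add_add_sq_le {q p e ε : ℝ} (hε : 0 ≤ ε) (he : |e| ≤ ε * q) :
    q ^ 2 + (p + e) ^ 2 ≤ (1 + ε) ^ 2 * (q ^ 2 + p ^ 2) := by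
  have h1 : e ^ 2 ≤ (ε * q) ^ 2 := sq_le_sq' (abs_le.1 he).1 (abs_le.1 he).2
  have h2 : p * e ≤ |p| * (ε * q) := by
    calc p * e ≤ |p * e| := le_abs_self _
      _ = |p| * |e| := abs_mul _ _
      _ ≤ _ := by gcongr
  have h3 : 0 ≤ ε * (|p| - q) ^ 2 := by positivity
  have h4 : |p| ^ 2 = p ^ 2 := sq_abs p
  nlinarith [mul_nonneg (sq_nonneg ε) (sq_nonneg p)]

theorem euclideanHausdorffMeasure_eq_zero_of_dimH_lt {X : Type*} [MetricSpace X]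
    [MeasurableSpace X] [BorelSpace X] {d : ℕ} {s : Set X} (h : dimH s < d) : μHE[d] s = 0 := by
  have : μH[((d : ℝ≥0) : ℝ)] s = 0 := hausdorffMeasure_of_dimH_lt (by simpa using h)
  rw [Measure.euclideanHausdorffMeasure_def, Measure.smul_apply]
  simp only [NNReal.coe_natCast] at this
  rw [this, smul_zero]

end LocalComparison

/-! ### Volume of the unit sphere in the stereographic chart. -/

section Sphere

variable {F : Type*} [NormedAddCommGroup F] [InnerProductSpace ℝ F] [FiniteDimensional ℝ F]
  [MeasurableSpace F] [BorelSpace F]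

/-- The chart misses only the pole `v`, a null set as `n > 0`; near `x` it is compared with the
homothety of ratio `stereoFactor x`. -/
theorem euclideanHausdorffMeasure_sphere_eq_lintegral {v : F} (hv : ‖v‖ = 1) {n : ℕ}
    (hn : finrank ℝ (ℝ ∙ v)ᗮ = n) (hpos : 0 < n) :
    μHE[n] (Metric.sphere (0 : F) 1) =
      ∫⁻ w : (ℝ ∙ v)ᗮ, ENNReal.ofReal (stereoFactor w ^ n) := by
  set φ : (ℝ ∙ v)ᗮ → F := fun w => stereoInvFun hv w with hφ
  have hsub : φ '' univ ⊆ Metric.sphere (0 : F) 1 := by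
    rintro _ ⟨w, -, rfl⟩
    exact (stereoInvFun hv w).2
  have hsup : Metric.sphere (0 : F) 1 ⊆ φ '' univ ∪ {v} := by
    intro e he
    by_cases h : e = v
    · exact Or.inr h
    · obtain ⟨w, hw⟩ := exists_stereoInvFun_eq hv (by simpa using he) h
      exact Or.inl ⟨w, mem_univ _, hw⟩
  have hpt : μHE[n] ({v} : Set F) = 0 :=
    euclideanHausdorffMeasure_eq_zero_of_dimH_lt (by simpa using hpos)
  have h1 : μHE[n] (Metric.sphere (0 : F) 1) = μHE[n] (φ '' univ) :=
    le_antisymm ((measure_mono hsup).trans ((measure_union_le _ _).trans (by rw [hpt, add_zero])))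
      (measure_mono hsub)
  rw [h1, ← setLIntegral_univ]
  refine euclideanHausdorffMeasure_image_eq_lintegral (V := (ℝ ∙ v)ᗮ) n MeasurableSet.univ
    ((Subtype.val_injective.comp (stereoInvFun_injective hv)).injOn)
    (continuous_subtype_val.comp (continuous_stereoInvFun hv)).continuousOn ?_
  intro x _ r hr
  have hr' : (1 : ℝ) < r := by exact_mod_cast hr
  have hlam := stereoFactor_pos x
  refine ⟨fun w => stereoFactor x • w, ENNReal.ofReal (stereoFactor x ^ n), fun t _ => ?_, ?_, ?_⟩
  · rw [← hn, InnerProductSpace.euclideanHausdorffMeasure_eq_volume, image_smul,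
      Measure.addHaar_smul, abs_of_nonneg (by positivity)]
  · have h := eventually_le_mul_and_le_mul continuous_stereoFactor.continuousAt hlam hr'
    filter_upwards [h.prod_mk h] with ⟨u, w⟩ ⟨⟨hu1, hu2⟩, hw1, hw2⟩
    have hu := stereoFactor_pos u
    have hw := stereoFactor_pos w
    simp only [dist_eq_norm, Function.comp_apply]
    constructor
    · refine (sq_le_sq₀ (by positivity) (by positivity)).1 ?_
      rw [norm_stereoInvFun_sub_sq, ← smul_sub, norm_smul, Real.norm_of_nonneg hlam.le]
      calc _ ≤ (r * stereoFactor x) * (r * stereoFactor x) * ‖u - w‖ ^ 2 := by gcongr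
        _ = _ := by ring
    · refine (sq_le_sq₀ (by positivity) (by positivity)).1 ?_
      rw [mul_pow, norm_stereoInvFun_sub_sq, ← smul_sub, norm_smul, Real.norm_of_nonneg hlam.le]
      calc _ = stereoFactor x * stereoFactor x * ‖u - w‖ ^ 2 := by ring
        _ ≤ (r * stereoFactor u) * (r * stereoFactor w) * ‖u - w‖ ^ 2 := by gcongr
        _ = _ := by ring
  · exact eventually_ofReal_le_mul_and_le_mul (continuous_stereoFactor.pow n).continuousAt
      (pow_pos hlam n) hr

end Sphere

/-! ### Jacobian of the parametrization of the array. -/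

section Array

theorem continuousAt_gradient {E : Type*} [NormedAddCommGroup E] [InnerProductSpace ℝ E]
    [CompleteSpace E] {f : E → ℝ} {x : E} (hf : ContDiffAt ℝ 1 f x) :
    ContinuousAt (gradient f) x :=
  (InnerProductSpace.toDual ℝ E).symm.continuous.continuousAt.comp
    (hf.fderiv_right (m := 0) le_rfl).continuousAt

theorem norm_toLp_prod_smul_sub_sq {E F : Type*} [NormedAddCommGroup E]
    [NormedAddCommGroup F] [InnerProductSpace ℝ F] {e₁ e₂ : F} (h₁ : ‖e₁‖ = 1) (h₂ : ‖e₂‖ = 1) (x y : E)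
    (a b : ℝ) :
    ‖WithLp.toLp 2 (x, a • e₁) - WithLp.toLp 2 (y, b • e₂)‖ ^ 2 =
      ‖x - y‖ ^ 2 + (a - b) ^ 2 + a * b * ‖e₁ - e₂‖ ^ 2 := by
  rw [WithLp.prod_norm_sq_eq_of_L2, add_assoc, ← norm_smul_sub_smul_sq h₁ h₂]
  rfl

variable {E F W : Type*} [NormedAddCommGroup E] [InnerProductSpace ℝ E] [FiniteDimensional ℝ E]
  [MeasurableSpace E] [BorelSpace E]
  [NormedAddCommGroup W] [InnerProductSpace ℝ W] [FiniteDimensional ℝ W]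
  [MeasurableSpace W] [BorelSpace W]

theorem euclideanHausdorffMeasure_image_prodMap_smul (P : E →ₗ[ℝ] E) (c : ℝ) (t : Set (E × W))
    {d : ℕ} (hd : finrank ℝ E + finrank ℝ W = d) :
    μHE[d] ((fun p : E × W => WithLp.toLp 2 (P p.1, c • p.2)) '' t) =
      ENNReal.ofReal |LinearMap.det P * c ^ finrank ℝ W| * volume t := by
  have h0 : finrank ℝ (WithLp 2 (E × W)) = d := by
    rw [(WithLp.linearEquiv 2 ℝ (E × W)).finrank_eq, finrank_prod, hd]
  have h1 : ((fun p : E × W => WithLp.toLp 2 (P p.1, c • p.2)) '' t) =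
      (WithLp.ofLp ⁻¹' ((P.prodMap (c • LinearMap.id : W →ₗ[ℝ] W)) '' t)) := by
    ext y
    constructor
    · rintro ⟨p, hp, rfl⟩
      exact ⟨p, hp, rfl⟩
    · rintro ⟨p, hp, h⟩
      exact ⟨p, hp, by rw [← WithLp.toLp_ofLp 2 y, ← h]; rfl⟩
  have : (volume : Measure (E × W)).IsAddHaarMeasure :=
    inferInstanceAs ((volume : Measure E).prod (volume : Measure W)).IsAddHaarMeasure
  rw [h1, ← h0, InnerProductSpace.euclideanHausdorffMeasure_eq_volume,
    (WithLp.volume_preserving_ofLp E W).measure_preimage_emb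
      (MeasurableEquiv.toLp 2 (E × W)).symm.measurableEmbedding,
    Measure.addHaar_image_linearMap, LinearMap.det_prodMap, LinearMap.det_smul, LinearMap.det_id,
    mul_one]

variable [NormedAddCommGroup F] [InnerProductSpace ℝ F] [FiniteDimensional ℝ F]
  [MeasurableSpace F] [BorelSpace F]

/-- Near `(x, u)` the model is the product of the linear map `P` with the graph metric of `∇f(x)`
and the homothety of ratio `f x * stereoFactor u`; its determinant is the Jacobian. -/
theorem euclideanHausdorffMeasure_image_stereo_eq_lintegral {v : F} (hv : ‖v‖ = 1) {f : E → ℝ}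
    {U : Set E} (hU : MeasurableSet U) (hf : ∀ x ∈ U, ContDiffAt ℝ 1 f x) (hpos : ∀ x ∈ U, 0 < f x)
    {d n : ℕ} (hn : finrank ℝ (ℝ ∙ v)ᗮ = n) (hd : finrank ℝ E + n = d) :
    μHE[d] ((fun p : E × (ℝ ∙ v)ᗮ => WithLp.toLp 2 (p.1, f p.1 • (stereoInvFun hv p.2 : F))) ''
        (U ×ˢ univ)) =
      ∫⁻ p in U ×ˢ (univ : Set (ℝ ∙ v)ᗮ),
        ENNReal.ofReal (√(1 + ‖gradient f p.1‖ ^ 2) * (f p.1 * stereoFactor p.2) ^ n) := by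
  refine euclideanHausdorffMeasure_image_eq_lintegral (V := WithLp 2 (E × (ℝ ∙ v)ᗮ)) d
    (hU.prod MeasurableSet.univ) ?_ ?_ ?_
  · rintro ⟨x, u⟩ ⟨hx, -⟩ ⟨y, w⟩ - hxy
    have h := congrArg WithLp.ofLp hxy
    simp only [Prod.mk.injEq] at h
    obtain ⟨rfl, h⟩ := h
    have h2 := stereoInvFun_injective hv (Subtype.val_injective (smul_right_injective _ (hpos x hx).ne' h))
    rw [h2]
  · refine (WithLp.prod_continuous_toLp 2 E F).comp_continuousOn ?_
    refine continuousOn_fst.prodMk (ContinuousOn.smul ?_ ?_)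
    · exact ContinuousOn.comp (t := U) (fun x hx => (hf x hx).continuousAt.continuousWithinAt)
        continuousOn_fst fun p hp => hp.1
    · exact (continuous_subtype_val.comp
        ((continuous_stereoInvFun hv).comp continuous_snd)).continuousOn
  rintro ⟨x, u⟩ ⟨hx, -⟩ r hr
  have hr' : (1 : ℝ) < r := by exact_mod_cast hr
  have hfx := hpos x hx
  have hlam := stereoFactor_pos u
  obtain ⟨P, hPdet, hP⟩ := exists_linearMap_norm_sq_eq_add_inner_sq (gradient f x)
  set c := f x * stereoFactor u with hc
  have hc0 : 0 < c := mul_pos hfx hlam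
  have hcont : ContinuousAt (fun p : E × (ℝ ∙ v)ᗮ => f p.1 * stereoFactor p.2) (x, u) :=
    ((hf x hx).continuousAt.comp (x := (x, u)) continuousAt_fst).mul
      (continuous_stereoFactor.comp continuous_snd).continuousAt
  refine ⟨fun p => WithLp.toLp 2 (P p.1, c • p.2),
    ENNReal.ofReal (√(1 + ‖gradient f x‖ ^ 2) * c ^ n), fun t _ => ?_, ?_, ?_⟩
  · rw [euclideanHausdorffMeasure_image_prodMap_smul P c t (by rw [hn, hd]), hPdet, hn,
      abs_of_nonneg (by positivity)]
  · have h := eventually_le_mul_and_le_mul hcont hc0 hr'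
    -- Strict differentiability is needed because both points of the pair vary near `x`.
    have hstrict := ((hf x hx).hasStrictFDerivAt one_ne_zero).isLittleO.bound
      (sub_pos.2 hr')
    have htend : Tendsto (fun z : (E × (ℝ ∙ v)ᗮ) × (E × (ℝ ∙ v)ᗮ) => (z.1.1, z.2.1))
        (𝓝 (x, u) ×ˢ 𝓝 (x, u)) (𝓝 (x, x)) := by
      rw [← nhds_prod_eq]
      exact Continuous.tendsto (by fun_prop) ((x, u), (x, u))
    filter_upwards [h.prod_mk h, htend.eventually hstrict]
    rintro ⟨⟨y, a⟩, ⟨z, b⟩⟩ ⟨⟨ha1, ha2⟩, hb1, hb2⟩ he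
    simp only at ha1 ha2 hb1 hb2 he
    set p := inner ℝ (gradient f x) (y - z) with hp
    have hpe : fderiv ℝ f x (y - z) = p := by
      rw [hp, gradient, InnerProductSpace.toDual_symm_apply]
    rw [hpe, Real.norm_eq_abs] at he
    have hya : 0 < f y * stereoFactor a := by nlinarith
    have hzb : 0 < f z * stereoFactor b := by nlinarith
    have hL : ‖WithLp.toLp 2 (P y, c • a) - WithLp.toLp 2 (P z, c • b)‖ ^ 2 =
        ‖y - z‖ ^ 2 + p ^ 2 + c ^ 2 * ‖a - b‖ ^ 2 := by
      rw [WithLp.prod_norm_sq_eq_of_L2]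
      change ‖P y - P z‖ ^ 2 + ‖c • a - c • b‖ ^ 2 = _
      rw [← map_sub, hP, ← smul_sub, norm_smul, mul_pow, Real.norm_eq_abs, sq_abs]
    have hφ := norm_toLp_prod_smul_sub_sq (norm_eq_of_mem_sphere (stereoInvFun hv a))
      (norm_eq_of_mem_sphere (stereoInvFun hv b)) y z (f y) (f z)
    rw [norm_stereoInvFun_sub_sq] at hφ
    have hr0 : (0 : ℝ) ≤ r - 1 := by linarith
    -- The same estimate is used in both directions, exchanging `p` with `f y - f z` and changing
    -- the sign of the error.
    have e1 := sq_add_add_sq_le (p := p) hr0 he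
    have e2 := sq_add_add_sq_le (p := f y - f z) (e := -(f y - f z - p)) hr0 (by rwa [abs_neg])
    simp only [dist_eq_norm]
    constructor
    · refine (sq_le_sq₀ (by positivity) (by positivity)).1 ?_
      rw [mul_pow, hL, hφ]
      have : f y * stereoFactor a * (f z * stereoFactor b) * ‖a - b‖ ^ 2 ≤
          (r * c) * (r * c) * ‖a - b‖ ^ 2 := by gcongr
      ring_nf at e1 this ⊢
      linarith
    · refine (sq_le_sq₀ (by positivity) (by positivity)).1 ?_
      rw [mul_pow, hL, hφ]
      have : c * c * ‖a - b‖ ^ 2 ≤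
          (r * (f y * stereoFactor a)) * (r * (f z * stereoFactor b)) * ‖a - b‖ ^ 2 := by gcongr
      ring_nf at e2 this ⊢
      linarith
  · refine eventually_ofReal_le_mul_and_le_mul
      (q := fun p : E × (ℝ ∙ v)ᗮ => √(1 + ‖gradient f p.1‖ ^ 2) * (f p.1 * stereoFactor p.2) ^ n)
      (x := (x, u)) ?_ (by positivity) hr
    refine ContinuousAt.mul ?_ (hcont.pow n)
    have : ContinuousAt (fun p : E × (ℝ ∙ v)ᗮ => gradient f p.1) (x, u) :=
      ContinuousAt.comp (g := gradient f) (f := Prod.fst) (continuousAt_gradient (hf x hx))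
        continuousAt_fst
    exact ((this.norm.pow 2).const_add 1).sqrt

end Array

/-! ### Volume of the array and the APP as a pointwise equation. -/

section SphericalArray

theorem baseProj_image_sphericalArray {m k : ℕ} (hk : 2 ≤ k) (Ω : Set (Euc m)) (f : Euc m → ℝ) :
    baseProj '' sphericalArray k Ω f = Ω := by
  refine Subset.antisymm (by rintro _ ⟨p, hp, rfl⟩; exact hp.1) fun x hx => ?_
  refine ⟨WithLp.toLp 2 (x, f x • EuclideanSpace.single ⟨0, by omega⟩ 1), ⟨hx, ?_⟩, rfl⟩
  simp [norm_smul]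

theorem finrank_orthogonal_span_euc {k : ℕ} (hk : 2 ≤ k) {v : Euc k} (hv : ‖v‖ = 1) :
    finrank ℝ (ℝ ∙ v)ᗮ = k - 1 := by
  have : Fact (finrank ℝ (Euc k) = (k - 1) + 1) := ⟨by simp; omega⟩
  exact Submodule.finrank_orthogonal_span_singleton (by rintro rfl; simp at hv)

theorem exists_norm_eq_one_euc {k : ℕ} (hk : 2 ≤ k) : ∃ v : Euc k, ‖v‖ = 1 :=
  ⟨EuclideanSpace.single ⟨0, by omega⟩ 1, by simp⟩

theorem unitSphereVol_eq_lintegral {k : ℕ} (hk : 2 ≤ k) {v : Euc k} (hv : ‖v‖ = 1) :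
    unitSphereVol k = ∫⁻ w : (ℝ ∙ v)ᗮ, ENNReal.ofReal (stereoFactor w ^ (k - 1)) :=
  euclideanHausdorffMeasure_sphere_eq_lintegral hv (finrank_orthogonal_span_euc hk hv) (by omega)

theorem unitSphereVol_ne_zero {k : ℕ} (hk : 2 ≤ k) : unitSphereVol k ≠ 0 := by
  obtain ⟨v, hv⟩ := exists_norm_eq_one_euc hk
  rw [unitSphereVol_eq_lintegral hk hv]
  exact lintegral_stereoFactor_ne_zero _

theorem unitSphereVol_ne_top {k : ℕ} (hk : 2 ≤ k) : unitSphereVol k ≠ ∞ := by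
  obtain ⟨v, hv⟩ := exists_norm_eq_one_euc hk
  rw [unitSphereVol_eq_lintegral hk hv]
  exact lintegral_stereoFactor_ne_top (finrank_orthogonal_span_euc hk hv).symm (by omega)

/-- The factor by which the projection of the array with warping function `f` scales volume,
relative to the volume of the unit sphere. -/
noncomputable def arrayDensity {m : ℕ} (k : ℕ) (f : Euc m → ℝ) (x : Euc m) : ℝ :=
  √(1 + ‖gradient f x‖ ^ 2) * f x ^ (k - 1)

theorem ContDiffOn.continuousOn_arrayDensity {m k : ℕ} {Ω : Set (Euc m)} (hΩ : IsOpen Ω)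
    {f : Euc m → ℝ} (hf : ContDiffOn ℝ 1 f Ω) : ContinuousOn (arrayDensity k f) Ω := by
  intro x hx
  have h := hf.contDiffAt (hΩ.mem_nhds hx)
  exact (((((continuousAt_gradient h).norm.pow 2).const_add 1).sqrt).mul
    (h.continuousAt.pow _)).continuousWithinAt

/-- Such a section contains all that the chart misses; as `m < m + k - 1` for `k ≥ 2`, the bound
makes it null. -/
theorem dimH_image_section_le {m k : ℕ} {Ω : Set (Euc m)} (hΩ : IsOpen Ω) {f : Euc m → ℝ}
    (hf : ContDiffOn ℝ 1 f Ω) (v : Euc k) :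
    dimH ((fun x => (WithLp.toLp 2 (x, f x • v) : Ambient m k)) '' Ω) ≤ m := by
  have h : dimH ((fun x => (WithLp.toLp 2 (x, f x • v) : Ambient m k)) '' Ω) ≤ dimH Ω := by
    refine dimH_image_le_of_locally_lipschitzOn fun x hx => ?_
    have hc : ContDiffAt ℝ 1 (fun x => (WithLp.toLp 2 (x, f x • v) : Ambient m k)) x :=
      (WithLp.prodContinuousLinearEquiv 2 ℝ (Euc m) (Euc k)).symm.contDiff.contDiffAt.comp x
        (contDiffAt_id.prodMk ((hf.contDiffAt (hΩ.mem_nhds hx)).smul contDiffAt_const))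
    obtain ⟨K, t, ht, hK⟩ := hc.exists_lipschitzOnWith
    exact ⟨K, t, mem_nhdsWithin_of_mem_nhds ht, hK⟩
  refine h.trans ((dimH_mono (subset_univ Ω)).trans ?_)
  rw [Real.dimH_univ_eq_finrank]
  simp

theorem euclideanHausdorffMeasure_sphericalArray_of_measurableSet {m k : ℕ} (hk : 2 ≤ k)
    {Ω : Set (Euc m)} (hΩ : IsOpen Ω) {f : Euc m → ℝ} (hf0 : ∀ x ∈ Ω, 0 ≤ f x)
    (hf : ContDiffOn ℝ 1 f Ω) {U : Set (Euc m)} (hU : U ⊆ Ω) (hUm : MeasurableSet U) :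
    μHE[m + k - 1] (sphericalArray k Ω f ∩ baseProj ⁻¹' U) =
      unitSphereVol k * ∫⁻ x in U, ENNReal.ofReal (arrayDensity k f x) := by
  obtain ⟨v, hv⟩ := exists_norm_eq_one_euc hk
  set P : Set (Euc m) := Ω ∩ f ⁻¹' Ioi 0 with hP
  have hPo : IsOpen P := hf.continuousOn.isOpen_inter_preimage hΩ isOpen_Ioi
  set ψ : Euc m × (ℝ ∙ v)ᗮ → Ambient m k :=
    fun p => WithLp.toLp 2 (p.1, f p.1 • (stereoInvFun hv p.2 : Euc k)) with hψ
  set γ : Euc m → Ambient m k := fun x => WithLp.toLp 2 (x, f x • v) with hγ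
  have hsub : ψ '' ((U ∩ P) ×ˢ univ) ⊆ sphericalArray k Ω f ∩ baseProj ⁻¹' U := by
    rintro _ ⟨⟨x, w⟩, ⟨hx, -⟩, rfl⟩
    refine ⟨⟨hU hx.1, ?_⟩, hx.1⟩
    change ‖f x • (stereoInvFun hv w : Euc k)‖ ^ 2 = f x ^ 2
    rw [norm_smul, norm_eq_of_mem_sphere, mul_one, Real.norm_eq_abs, sq_abs]
  -- The points outside the chart have `f = 0` or direction `v`; both kinds lie on the section `γ`.
  have hsup : sphericalArray k Ω f ∩ baseProj ⁻¹' U ⊆ ψ '' ((U ∩ P) ×ˢ univ) ∪ γ '' Ω := by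
    rintro p ⟨⟨hp, hpn⟩, hpU⟩
    have hnn := hf0 p.fst hp
    have hnorm : ‖p.snd‖ = f p.fst := (pow_left_inj₀ (norm_nonneg _) hnn two_ne_zero).1 hpn
    rcases hnn.eq_or_lt with h0 | hpos
    · refine Or.inr ⟨p.fst, hp, ?_⟩
      have hz : p.snd = 0 := by rw [← norm_eq_zero, hnorm, h0]
      simp only [hγ, ← h0, zero_smul]
      rw [← hz]
      rfl
    · have he : ‖(f p.fst)⁻¹ • p.snd‖ = 1 := by
        rw [norm_smul, hnorm, norm_inv, Real.norm_of_nonneg hnn, inv_mul_cancel₀ hpos.ne']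
      have hsm : f p.fst • (f p.fst)⁻¹ • p.snd = p.snd := by
        rw [smul_smul, mul_inv_cancel₀ hpos.ne', one_smul]
      by_cases h : (f p.fst)⁻¹ • p.snd = v
      · refine Or.inr ⟨p.fst, hp, ?_⟩
        simp only [hγ, ← h, hsm]
        rfl
      · obtain ⟨w, hw⟩ := exists_stereoInvFun_eq hv he h
        refine Or.inl ⟨(p.fst, w), ⟨⟨hpU, hp, hpos⟩, mem_univ _⟩, ?_⟩
        simp only [hψ, hw, hsm]
        rfl
  have hγ0 : μHE[m + k - 1] (γ '' Ω) = 0 := by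
    refine euclideanHausdorffMeasure_eq_zero_of_dimH_lt
      ((dimH_image_section_le hΩ hf v).trans_lt ?_)
    exact_mod_cast (by omega : m < m + k - 1)
  have h1 : μHE[m + k - 1] (sphericalArray k Ω f ∩ baseProj ⁻¹' U) =
      μHE[m + k - 1] (ψ '' ((U ∩ P) ×ˢ univ)) :=
    le_antisymm ((measure_mono hsup).trans ((measure_union_le _ _).trans (by rw [hγ0, add_zero])))
      (measure_mono hsub)
  have hfin := finrank_orthogonal_span_euc hk hv
  rw [h1, euclideanHausdorffMeasure_image_stereo_eq_lintegral hv (hUm.inter hPo.measurableSet)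
    (fun x hx => hf.contDiffAt (hΩ.mem_nhds hx.2.1)) (fun x hx => hx.2.2) hfin
    (by rw [finrank_euclideanSpace_fin]; omega)]
  have hdens : ∀ p ∈ (U ∩ P) ×ˢ (univ : Set (ℝ ∙ v)ᗮ),
      ENNReal.ofReal (√(1 + ‖gradient f p.1‖ ^ 2) * (f p.1 * stereoFactor p.2) ^ (k - 1)) =
      ENNReal.ofReal (arrayDensity k f p.1) * ENNReal.ofReal (stereoFactor p.2 ^ (k - 1)) := by
    intro p hp
    have hpos : 0 < f p.1 := hp.1.2.2
    rw [← ENNReal.ofReal_mul (by unfold arrayDensity; positivity), arrayDensity, mul_pow, mul_assoc]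
  have hmeas : AEMeasurable (fun x => ENNReal.ofReal (arrayDensity k f x))
      (volume.restrict (U ∩ P)) :=
    (((hf.continuousOn_arrayDensity hΩ).mono fun x hx => hU hx.1).aemeasurable
      (hUm.inter hPo.measurableSet)).ennreal_ofReal
  -- Off `P` the factor `f ^ (k - 1)` vanishes, the exponent being at least `1`.
  have hzero : ∫⁻ x in U \ P, ENNReal.ofReal (arrayDensity k f x) = 0 := by
    rw [← lintegral_zero (μ := volume.restrict (U \ P))]
    refine setLIntegral_congr_fun (hUm.diff hPo.measurableSet) fun x hx => ?_
    have : f x = 0 := le_antisymm (not_lt.1 fun h => hx.2 ⟨hU hx.1, h⟩) (hf0 x (hU hx.1))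
    have hk1 : k - 1 ≠ 0 := by omega
    simp only [arrayDensity, this, zero_pow hk1, mul_zero, ENNReal.ofReal_zero]
  rw [setLIntegral_congr_fun ((hUm.inter hPo.measurableSet).prod MeasurableSet.univ) hdens,
    Measure.volume_eq_prod, ← Measure.prod_restrict,
    lintegral_prod_mul (g := fun w : (ℝ ∙ v)ᗮ => ENNReal.ofReal (stereoFactor w ^ (k - 1))) hmeas
      (continuous_stereoFactor.pow _).measurable.ennreal_ofReal.aemeasurable,
    setLIntegral_univ, ← unitSphereVol_eq_lintegral hk hv, mul_comm,
    ← lintegral_inter_add_sdiff (fun x => ENNReal.ofReal (arrayDensity k f x)) U hPo.measurableSet,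
    hzero, add_zero]

/-- The volume of the part of a spherical array over `U`. -/
theorem euclideanHausdorffMeasure_sphericalArray {m k : ℕ} (hk : 2 ≤ k)
    {Ω : Set (Euc m)} (hΩ : IsOpen Ω) {f : Euc m → ℝ} (hf0 : ∀ x ∈ Ω, 0 ≤ f x)
    (hf : ContDiffOn ℝ 1 f Ω) {U : Set (Euc m)} (hU : U ⊆ Ω) (hUm : NullMeasurableSet U volume) :
    μHE[m + k - 1] (sphericalArray k Ω f ∩ baseProj ⁻¹' U) =
      unitSphereVol k * ∫⁻ x in U, ENNReal.ofReal (arrayDensity k f x) := by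
  obtain ⟨T, hTU, hTm, hTe⟩ := hUm.exists_measurable_subset_ae_eq
  have hnull : volume (U \ T) = 0 := ae_le_set.1 hTe.symm.le
  -- The array has no volume over the null set `U \ T`: the measurable case applies to its hull `Z`
  -- cut down to `Ω`.
  set Z := toMeasurable volume (U \ T)
  have hZ : volume (Z ∩ Ω) = 0 :=
    measure_mono_null inter_subset_left (by rw [measure_toMeasurable, hnull])
  have key := fun {V : Set (Euc m)} (hV : V ⊆ Ω) (hVm : MeasurableSet V) =>
    euclideanHausdorffMeasure_sphericalArray_of_measurableSet hk hΩ hf0 hf hV hVm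
  have hZ0 : μHE[m + k - 1] (sphericalArray k Ω f ∩ baseProj ⁻¹' (Z ∩ Ω)) = 0 := by
    rw [key inter_subset_right ((measurableSet_toMeasurable _ _).inter hΩ.measurableSet),
      setLIntegral_measure_zero _ _ hZ, mul_zero]
  rw [setLIntegral_congr hTe.symm, ← key (hTU.trans hU) hTm]
  refine le_antisymm ?_ (measure_mono (inter_subset_inter_right _ (preimage_mono hTU)))
  have hsub : sphericalArray k Ω f ∩ baseProj ⁻¹' U ⊆
      (sphericalArray k Ω f ∩ baseProj ⁻¹' T) ∪ (sphericalArray k Ω f ∩ baseProj ⁻¹' (Z ∩ Ω)) := by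
    rintro p ⟨hp, hpU⟩
    by_cases h : baseProj p ∈ T
    · exact Or.inl ⟨hp, h⟩
    · exact Or.inr ⟨hp, subset_toMeasurable _ _ ⟨hpU, h⟩, hU hpU⟩
  exact (measure_mono hsub).trans ((measure_union_le _ _).trans (by rw [hZ0, add_zero]))

/-- The Archimedean projection property, with the volume of the unit sphere as constant, says that
the density of the projection is `1`. -/
theorem satisfiesAPP_sphericalArray_iff {m k : ℕ} (hk : 2 ≤ k)
    {Ω : Set (Euc m)} (hΩ : IsOpen Ω) {f : Euc m → ℝ} (hf0 : ∀ x ∈ Ω, 0 ≤ f x)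
    (hf : ContDiffOn ℝ 1 f Ω) :
    SatisfiesAPP (sphericalArray k Ω f) (unitSphereVol k) ↔ ∀ x ∈ Ω, arrayDensity k f x = 1 := by
  have hσ0 := unitSphereVol_ne_zero hk
  have hσt := unitSphereVol_ne_top hk
  rw [SatisfiesAPP, baseProj_image_sphericalArray hk]
  constructor
  · rintro ⟨-, -, h⟩
    have hc := hf.continuousOn_arrayDensity (k := k) hΩ
    have hint : ∀ U ⊆ Ω, MeasurableSet U →
        ∫⁻ x in U, ENNReal.ofReal (arrayDensity k f x) = volume U := by
      intro U hU hUm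
      have := h U hU hUm.nullMeasurableSet
      rw [euclideanHausdorffMeasure_sphericalArray hk hΩ hf0 hf hU hUm.nullMeasurableSet] at this
      exact (ENNReal.mul_right_inj hσ0 hσt).1 this
    have hae : ∀ᵐ x ∂volume.restrict Ω, arrayDensity k f x = 1 := by
      have h1 : (fun x => ENNReal.ofReal (arrayDensity k f x)) =ᵐ[volume.restrict Ω] fun _ => 1 := by
        refine ae_eq_of_forall_setLIntegral_eq_of_sigmaFinite₀
          (hc.aemeasurable hΩ.measurableSet).ennreal_ofReal aemeasurable_const fun U hUm _ => ?_
        rw [Measure.restrict_restrict hUm, hint _ inter_subset_right (hUm.inter hΩ.measurableSet)]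
        simp
      filter_upwards [h1] with x hx
      simpa using hx
    intro x hx
    exact Measure.eqOn_open_of_ae_eq hae hΩ hc continuousOn_const hx
  · intro h
    refine ⟨hσ0, hσt, fun U hU hUm => ?_⟩
    rw [euclideanHausdorffMeasure_sphericalArray hk hΩ hf0 hf hU hUm]
    congr 1
    calc _ = ∫⁻ _ in U, 1 := lintegral_congr_ae (by
          filter_upwards [ae_restrict_mem₀ hUm] with x hx
          rw [h x (hU hx), ENNReal.ofReal_one])
      _ = _ := by simp

end SphericalArray

/-! ### Regularity of the Archimedean integral and of its inverse. -/

section Scaling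

/-- The integrand `t^(k-1) / √(1 - t^(2k-2))` of the Archimedean integral. -/
noncomputable def archimedeanIntegrand (k : ℕ) (t : ℝ) : ℝ :=
  t ^ (k - 1) / √(1 - t ^ (2 * k - 2))

variable {k : ℕ} (hk : 2 ≤ k)
include hk

theorem one_sub_pow_pos {t : ℝ} (h0 : 0 ≤ t) (h1 : t < 1) : 0 < 1 - t ^ (2 * k - 2) :=
  sub_pos.2 (pow_lt_one₀ h0 h1 (by omega))

theorem archimedeanIntegrand_pos {t : ℝ} (ht : t ∈ Ioo (0 : ℝ) 1) :
    0 < archimedeanIntegrand k t :=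
  div_pos (pow_pos ht.1 _) (Real.sqrt_pos.2 (one_sub_pow_pos hk ht.1.le ht.2))

theorem continuousAt_archimedeanIntegrand {t : ℝ} (ht : t ∈ Ioo (0 : ℝ) 1) :
    ContinuousAt (archimedeanIntegrand k) t := by
  refine ContinuousAt.div (by fun_prop) (by fun_prop) ?_
  exact (Real.sqrt_pos.2 (one_sub_pow_pos hk ht.1.le ht.2)).ne'

/-- The singularity at `1` is dominated by `1 / √(1 - t²)`, the derivative of `arcsin`. -/
theorem intervalIntegrable_archimedeanIntegrand :
    IntervalIntegrable (archimedeanIntegrand k) volume 0 1 := by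
  have h : IntegrableOn (fun t : ℝ => 1 / √(1 - t ^ 2)) (Ioc 0 1) := by
    refine intervalIntegral.integrableOn_deriv_of_nonneg (g := Real.arcsin)
      Real.continuous_arcsin.continuousOn (fun x hx => ?_) fun x _ => by positivity
    exact Real.hasDerivAt_arcsin (by linarith [hx.1]) hx.2.ne
  rw [intervalIntegrable_iff_integrableOn_Ioo_of_le zero_le_one]
  refine (h.mono_set Ioo_subset_Ioc_self).mono' ?_ ?_
  · exact ContinuousOn.aestronglyMeasurable (fun t ht =>
      (continuousAt_archimedeanIntegrand hk ht).continuousWithinAt) measurableSet_Ioo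
  · filter_upwards [ae_restrict_mem measurableSet_Ioo] with t ht
    rw [Real.norm_of_nonneg (archimedeanIntegrand_pos hk ht).le, archimedeanIntegrand]
    have h2 : t ^ (2 * k - 2) ≤ t ^ 2 := pow_le_pow_of_le_one ht.1.le ht.2.le (by omega)
    have h3 : 0 < 1 - t ^ 2 := sub_pos.2 (pow_lt_one₀ ht.1.le ht.2 two_ne_zero)
    have h4 : t ^ (k - 1) ≤ 1 := pow_le_one₀ ht.1.le ht.2.le
    gcongr

theorem continuousOn_archimedeanIntegral : ContinuousOn (archimedeanIntegral k) (Icc 0 1) := by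
  have := intervalIntegral.continuousOn_primitive_interval'
    (intervalIntegrable_archimedeanIntegrand hk) left_mem_uIcc
  rwa [uIcc_of_le zero_le_one] at this

theorem hasDerivAt_archimedeanIntegral {y : ℝ} (hy : y ∈ Ioo (0 : ℝ) 1) :
    HasDerivAt (archimedeanIntegral k) (archimedeanIntegrand k y) y := by
  refine intervalIntegral.integral_hasDerivAt_right ?_ ?_ (continuousAt_archimedeanIntegrand hk hy)
  · exact (intervalIntegrable_archimedeanIntegrand hk).mono_set
      (by rw [uIcc_of_le hy.1.le, uIcc_of_le zero_le_one]; exact Icc_subset_Icc_right hy.2.le)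
  · exact ContinuousOn.stronglyMeasurableAtFilter isOpen_Ioo (fun t ht =>
      (continuousAt_archimedeanIntegrand hk ht).continuousWithinAt) y hy

theorem strictMonoOn_archimedeanIntegral : StrictMonoOn (archimedeanIntegral k) (Icc 0 1) := by
  refine strictMonoOn_of_deriv_pos (convex_Icc _ _) (continuousOn_archimedeanIntegral hk) ?_
  intro x hx
  rw [interior_Icc] at hx
  rw [(hasDerivAt_archimedeanIntegral hk hx).deriv]
  exact archimedeanIntegrand_pos hk hx

omit hk in
theorem archimedeanIntegral_zero : archimedeanIntegral k 0 = 0 := intervalIntegral.integral_same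

theorem contDiffOn_archimedeanIntegral :
    ContDiffOn ℝ 1 (archimedeanIntegral k) (Ioo 0 1) := by
  rw [contDiffOn_one_iff_derivWithin isOpen_Ioo.uniqueDiffOn]
  refine ⟨fun y hy => (hasDerivAt_archimedeanIntegral hk hy).differentiableAt.differentiableWithinAt,
    ContinuousOn.congr (f := archimedeanIntegrand k)
      (fun y hy => (continuousAt_archimedeanIntegrand hk hy).continuousWithinAt) fun y hy => ?_⟩
  exact (hasDerivAt_archimedeanIntegral hk hy).hasDerivWithinAt.derivWithin
    (isOpen_Ioo.uniqueDiffWithinAt hy)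

theorem archimedeanScaling_archimedeanIntegral {y : ℝ} (hy : y ∈ Icc (0 : ℝ) 1) :
    archimedeanScaling k (archimedeanIntegral k y) = y :=
  (strictMonoOn_archimedeanIntegral hk).injOn.leftInvOn_invFunOn hy

theorem exists_archimedeanIntegral_eq {w : ℝ} (hw : w ∈ Ioo 0 (archimedeanBound k)) :
    ∃ y ∈ Ioo (0 : ℝ) 1, archimedeanIntegral k y = w := by
  have := intermediate_value_Ioo zero_le_one (continuousOn_archimedeanIntegral hk)
  rw [archimedeanIntegral_zero] at this
  exact this hw

theorem archimedeanScaling_mem_Ioo {w : ℝ} (hw : w ∈ Ioo 0 (archimedeanBound k)) :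
    archimedeanScaling k w ∈ Ioo (0 : ℝ) 1 := by
  obtain ⟨y, hy, rfl⟩ := exists_archimedeanIntegral_eq hk hw
  rwa [archimedeanScaling_archimedeanIntegral hk (Ioo_subset_Icc_self hy)]

theorem archimedeanIntegral_archimedeanScaling {w : ℝ} (hw : w ∈ Ioo 0 (archimedeanBound k)) :
    archimedeanIntegral k (archimedeanScaling k w) = w := by
  obtain ⟨y, hy, rfl⟩ := exists_archimedeanIntegral_eq hk hw
  rw [archimedeanScaling_archimedeanIntegral hk (Ioo_subset_Icc_self hy)]

theorem archimedeanIntegral_mem_Ioo {y : ℝ} (hy : y ∈ Ioo (0 : ℝ) 1) :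
    archimedeanIntegral k y ∈ Ioo 0 (archimedeanBound k) := by
  have hm := strictMonoOn_archimedeanIntegral hk
  have hy' := Ioo_subset_Icc_self hy
  constructor
  · have := hm (left_mem_Icc.2 zero_le_one) hy' hy.1
    rwa [archimedeanIntegral_zero] at this
  · exact hm hy' (right_mem_Icc.2 zero_le_one) hy.2

theorem continuousAt_archimedeanScaling {w : ℝ} (hw : w ∈ Ioo 0 (archimedeanBound k)) :
    ContinuousAt (archimedeanScaling k) w := by
  refine StrictMonoOn.continuousAt_of_image_mem_nhds (s := Ioo 0 (archimedeanBound k)) ?_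
    (isOpen_Ioo.mem_nhds hw) ?_
  · intro a ha b hb hab
    refine ((strictMonoOn_archimedeanIntegral hk).lt_iff_lt
      (Ioo_subset_Icc_self (archimedeanScaling_mem_Ioo hk ha))
      (Ioo_subset_Icc_self (archimedeanScaling_mem_Ioo hk hb))).1 ?_
    rwa [archimedeanIntegral_archimedeanScaling hk ha, archimedeanIntegral_archimedeanScaling hk hb]
  · refine mem_of_superset (isOpen_Ioo.mem_nhds (archimedeanScaling_mem_Ioo hk hw)) fun y hy => ?_
    exact ⟨_, archimedeanIntegral_mem_Ioo hk hy,
      archimedeanScaling_archimedeanIntegral hk (Ioo_subset_Icc_self hy)⟩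

theorem hasDerivAt_archimedeanScaling {w : ℝ} (hw : w ∈ Ioo 0 (archimedeanBound k)) :
    HasDerivAt (archimedeanScaling k) (archimedeanIntegrand k (archimedeanScaling k w))⁻¹ w := by
  have hmem := archimedeanScaling_mem_Ioo hk hw
  refine HasDerivAt.of_local_left_inverse (continuousAt_archimedeanScaling hk hw)
    (hasDerivAt_archimedeanIntegral hk hmem) (archimedeanIntegrand_pos hk hmem).ne' ?_
  filter_upwards [isOpen_Ioo.mem_nhds hw] with z hz
  exact archimedeanIntegral_archimedeanScaling hk hz

theorem contDiffOn_archimedeanScaling :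
    ContDiffOn ℝ 1 (archimedeanScaling k) (Ioo 0 (archimedeanBound k)) := by
  rw [contDiffOn_one_iff_derivWithin isOpen_Ioo.uniqueDiffOn]
  refine ⟨fun w hw => (hasDerivAt_archimedeanScaling hk hw).differentiableAt.differentiableWithinAt,
    ContinuousOn.congr (f := fun w => (archimedeanIntegrand k (archimedeanScaling k w))⁻¹)
      (fun w hw => ?_) fun w hw => ?_⟩
  · have hmem := archimedeanScaling_mem_Ioo hk hw
    exact (((continuousAt_archimedeanIntegrand hk hmem).comp
      (continuousAt_archimedeanScaling hk hw)).inv₀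
        (archimedeanIntegrand_pos hk hmem).ne').continuousWithinAt
  · exact (hasDerivAt_archimedeanScaling hk hw).hasDerivWithinAt.derivWithin
      (isOpen_Ioo.uniqueDiffWithinAt hw)

/-- With `G = ‖∇f‖`, this turns density one into the eikonal equation. Both sides are nonnegative,
and squared they read `(1 + G²) * y ^ (2 * k - 2) = 1`. -/
theorem sqrt_one_add_sq_mul_pow_eq_one_iff {y G : ℝ} (hy : y ∈ Ioo (0 : ℝ) 1) (hG : 0 ≤ G) :
    √(1 + G ^ 2) * y ^ (k - 1) = 1 ↔ archimedeanIntegrand k y * G = 1 := by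
  have h1 := one_sub_pow_pos hk hy.1.le hy.2
  have hp : y ^ (2 * k - 2) = (y ^ (k - 1)) ^ 2 := by
    rw [← pow_mul]
    congr 1
    omega
  have hy0 : 0 < y ^ (k - 1) := pow_pos hy.1 _
  rw [← pow_left_inj₀ (by positivity) zero_le_one two_ne_zero,
    ← pow_left_inj₀ (mul_nonneg (archimedeanIntegrand_pos hk hy).le hG) zero_le_one two_ne_zero,
    archimedeanIntegrand, mul_pow, mul_pow, div_pow, Real.sq_sqrt (by positivity),
    Real.sq_sqrt h1.le, hp, one_pow]
  rw [hp] at h1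
  rw [div_mul_eq_mul_div, div_eq_one_iff_eq h1.ne']
  constructor <;> intro h <;> linarith

end Scaling

/-! ### From density one to the eikonal equation and back. -/

theorem norm_gradient_comp {E : Type*} [NormedAddCommGroup E] [InnerProductSpace ℝ E]
    [CompleteSpace E] {u : E → ℝ} {g : ℝ → ℝ} {g' : ℝ} {x : E} (hg : HasDerivAt g g' (u x))
    (hu : DifferentiableAt ℝ u x) :
    ‖gradient (fun z => g (u z)) x‖ = |g'| * ‖gradient u x‖ := by
  have h : fderiv ℝ (fun z => g (u z)) x = g' • fderiv ℝ u x :=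
    (hg.comp_hasFDerivAt x hu.hasFDerivAt).fderiv
  simp only [gradient, LinearIsometryEquiv.norm_map, h, norm_smul, Real.norm_eq_abs]

theorem le_one_of_arrayDensity_eq_one {m k : ℕ} (hk : 2 ≤ k) {f : Euc m → ℝ} {x : Euc m}
    (h : arrayDensity k f x = 1) : f x ≤ 1 := by
  by_contra! hlt
  have h1 : 1 < f x ^ (k - 1) := one_lt_pow₀ hlt (by omega)
  have h2 : 1 ≤ √(1 + ‖gradient f x‖ ^ 2) :=
    Real.one_le_sqrt.2 (by nlinarith [sq_nonneg ‖gradient f x‖])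
  unfold arrayDensity at h
  nlinarith

/-- A point with `ω x = M` would be an interior maximum, where the gradient is `0` and not of norm
`1`. -/
theorem IsPositiveEikonalSolution.lt_of_forall_le {m : ℕ} {Ω : Set (Euc m)} (hΩ : IsOpen Ω)
    {ω : Euc m → ℝ} (hω : IsPositiveEikonalSolution ω Ω) {M : ℝ} (hM : ∀ x ∈ Ω, ω x ≤ M)
    {x : Euc m} (hx : x ∈ Ω) : ω x < M := by
  refine (hM x hx).lt_of_ne fun h => ?_
  have hmax : IsLocalMax ω x := by
    filter_upwards [hΩ.mem_nhds hx] with y hy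
    rw [h]
    exact hM y hy
  have := hω.2.2 x hx
  rw [gradient, hmax.fderiv_eq_zero, map_zero, norm_zero] at this
  exact zero_ne_one this

theorem theorem1 (m k : ℕ) (hm : 1 ≤ m) (hk : 2 ≤ k)
    (Ω : Set (Euc m)) (hΩ : IsOpen Ω) (hΩc : IsConnected Ω) :
    -- Part (a)
    (∀ f : Euc m → ℝ, (∀ x ∈ Ω, 0 ≤ f x) → ContDiffOn ℝ 1 f Ω →
      SatisfiesAPP (sphericalArray k Ω f) (unitSphereVol k) →
      (∀ x ∈ Ω, f x ≤ 1) ∧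
      ∃ ω : Euc m → ℝ,
        IsPositiveEikonalSolution ω {x ∈ Ω | 0 < f x ∧ f x < 1} ∧
        ∀ x ∈ {x ∈ Ω | 0 < f x ∧ f x < 1},
          ω x ≤ archimedeanBound k ∧ f x = archimedeanScaling k (ω x)) ∧
    -- Part (b)
    (∀ ω : Euc m → ℝ, IsPositiveEikonalSolution ω Ω →
      (∀ x ∈ Ω, ω x ≤ archimedeanBound k) →
      (∀ x ∈ {x ∈ Ω | 0 < ω x ∧ ω x ≤ archimedeanBound k}, 0 ≤ archimedeanScaling k (ω x)) ∧
      ContDiffOn ℝ 1 (fun x => archimedeanScaling k (ω x))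
        {x ∈ Ω | 0 < ω x ∧ ω x ≤ archimedeanBound k} ∧
      SatisfiesAPP
        (sphericalArray k {x ∈ Ω | 0 < ω x ∧ ω x ≤ archimedeanBound k}
          (fun x => archimedeanScaling k (ω x)))
        (unitSphereVol k)) := by
  constructor
  · intro f hf0 hf hAPP
    rw [satisfiesAPP_sphericalArray_iff hk hΩ hf0 hf] at hAPP
    refine ⟨fun x hx => le_one_of_arrayDensity_eq_one hk (hAPP x hx),
      fun x => archimedeanIntegral k (f x), ⟨fun x hx => ?_, ?_, fun x hx => ?_⟩, fun x hx => ?_⟩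
    · exact (archimedeanIntegral_mem_Ioo hk hx.2).1
    · exact (contDiffOn_archimedeanIntegral hk).comp (hf.mono fun x hx => hx.1) fun x hx => hx.2
    · rw [norm_gradient_comp (hasDerivAt_archimedeanIntegral hk hx.2)
        ((hf.contDiffAt (hΩ.mem_nhds hx.1)).differentiableAt one_ne_zero),
        abs_of_pos (archimedeanIntegrand_pos hk hx.2)]
      exact (sqrt_one_add_sq_mul_pow_eq_one_iff hk hx.2 (norm_nonneg _)).1 (hAPP x hx.1)
    · exact ⟨(archimedeanIntegral_mem_Ioo hk hx.2).2.le,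
        (archimedeanScaling_archimedeanIntegral hk (Ioo_subset_Icc_self hx.2)).symm⟩
  · intro ω hω hle
    have hmem : ∀ x ∈ Ω, ω x ∈ Ioo 0 (archimedeanBound k) := fun x hx =>
      ⟨hω.1 x hx, hω.lt_of_forall_le hΩ hle hx⟩
    -- `B` is all of `Ω`, hence open, so the density criterion applies to it.
    have hB : {x ∈ Ω | 0 < ω x ∧ ω x ≤ archimedeanBound k} = Ω :=
      Subset.antisymm (fun x hx => hx.1) fun x hx => ⟨hx, (hmem x hx).1, (hmem x hx).2.le⟩
    have hnn : ∀ x ∈ Ω, 0 ≤ archimedeanScaling k (ω x) := fun x hx =>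
      (archimedeanScaling_mem_Ioo hk (hmem x hx)).1.le
    have hC : ContDiffOn ℝ 1 (fun x => archimedeanScaling k (ω x)) Ω :=
      (contDiffOn_archimedeanScaling hk).comp hω.2.1 hmem
    rw [hB]
    refine ⟨hnn, hC, (satisfiesAPP_sphericalArray_iff hk hΩ hnn hC).2 fun x hx => ?_⟩
    have hy := archimedeanScaling_mem_Ioo hk (hmem x hx)
    have hpos := archimedeanIntegrand_pos hk hy
    refine (sqrt_one_add_sq_mul_pow_eq_one_iff hk hy (norm_nonneg _)).2 ?_
    rw [norm_gradient_comp (hasDerivAt_archimedeanScaling hk (hmem x hx))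
      ((hω.2.1.contDiffAt (hΩ.mem_nhds hx)).differentiableAt one_ne_zero), hω.2.2 x hx, mul_one,
      abs_of_pos (inv_pos.2 hpos), mul_inv_cancel₀ hpos.ne']
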